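/- Let $f$ be a function of the Ruijsenaars class, i.e. $f$ is analytic for $\Re t>0$ and at $t=0$, and for every $\chi<\pi/2$ it is of at most polynomial growth as $t\to\infty$, uniformly in the sector $|\arg t|\le\chi$; assume that $f(t)>0$ for real $t\ge 0$. For an integer $M\ge 0$ and $\Re w>0$ let $$\zeta_M(s,w)=\frac1{\Gamma(s)}\int_0^\infty t^{s-1}e^{-wt}f(t)\,\frac{dt}{t^M},\qquad \Re s>M,$$ continued analytically in $s$ to $\mathbb C\setminus\{1,\dots,M\}$, and let $L_M(w)=\partial_s\zeta_M(s,w)|_{s=0}$, continued analytically from $\Re w>0$ to $w\in\mathbb C\setminus(-\infty,0]$. Let $(b_k)_{k\ge 0}$ be positive real numbers and let $N\ge 0$ be an integer. For a function $F$ put $$(\mathcal S_NF)(q\,|\,b)=\sum_{p=0}^N(-1)^p\sum_{1\le k_1<\dots<k_p\le N}F(q+b_0+b_{k_1}+\dots+b_{k_p}),$$ and for $q\in\mathbb C\setminus(-\infty,-b_0]$ put $$\eta_{M,N}(q\,|\,b)=\exp\bigl((\mathcal S_NL_M)(q\,|\,b)-(\mathcal S_NL_M)(0\,|\,b)\bigr).$$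 Theorem (Asymptotics). (1) If $M<N$, then for every $\delta>0$, as $q\to\infty$ in the sector $|\arg q|\le\pi-\delta$, $$\eta_{M,N}(q\,|\,b)\longrightarrow\exp\bigl(-(\mathcal S_NL_M)(0\,|\,b)\bigr).$$ (2) If $M=N$, then $$\eta_{N,N}(q\,|\,b)=\exp\bigl(-b_1\cdots b_N\,f(0)\log q+O(1)\bigr),$$ where $\log$ is the principal branch and where, for every $\delta>0$, the term $O(1)$ is bounded as $q\to\infty$ in the sector $|\arg q|\le\pi-\delta$. Here the exponents agree: $(\mathcal S_NL_N)(q\,|\,b)-(\mathcal S_NL_N)(0\,|\,b)=-b_1\cdots b_N\,f(0)\log q+O(1)$ with the same $O(1)$. -/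

import Mathlib

open Filter Topology

namespace BarnesBeta

/-- The Ruijsenaars class: functions analytic for `Re t > 0` and at `t = 0`, of at worst
polynomial growth as `t → ∞` in every closed subsector `|arg t| ≤ χ < π/2` of the right
half-plane (the exponent may depend on the subsector). -/
structure RuijsenaarsClass (f : ℂ → ℂ) : Prop where
  analytic_right : AnalyticOnNhd ℂ f {t : ℂ | 0 < t.re}
  analytic_zero : AnalyticAt ℂ f 0
  growth : ∀ χ : ℝ, χ < Real.pi / 2 → ∃ k : ℕ,
    f =O[Bornology.cobounded ℂ ⊓ 𝓟 {t : ℂ | |t.arg| ≤ χ}] fun t : ℂ => ‖t‖ ^ k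

/-- `G` is an analytic continuation to `U` of the function `g`, given on `S`. -/
def IsAnalyticContinuation (g : ℂ → ℂ) (S U : Set ℂ) (G : ℂ → ℂ) : Prop :=
  AnalyticOnNhd ℂ G U ∧ Set.EqOn G g S

open Classical in
/-- The analytic continuation to `U` of the function `g`, given on `S`, and zero if there is none.
It is used below only for `S` nonempty and open and `U ⊇ S` open and connected, where its values
on `U` are uniquely determined. -/
noncomputable def analyticContinuation (g : ℂ → ℂ) (S U : Set ℂ) : ℂ → ℂ :=
  if h : ∃ G : ℂ → ℂ, IsAnalyticContinuation g S U G then h.choose else 0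

/-- The integral defining the generalized zeta function `ζ_M(s, w)` for `Re s > M`, `Re w > 0`. -/
noncomputable def zetaIntegral (f : ℂ → ℂ) (M : ℕ) (s w : ℂ) : ℂ :=
  1 / Complex.Gamma s *
    ∫ t in Set.Ioi (0 : ℝ), (t : ℂ) ^ (s - 1) * Complex.exp (-w * t) * (f t / (t : ℂ) ^ M)

/-- The generalized zeta function `ζ_M(s, w)`, `Re w > 0`, continued analytically in `s` from
`Re s > M` to the complex plane without the points `1, …, M`. -/
noncomputable def zeta (f : ℂ → ℂ) (M : ℕ) (s w : ℂ) : ℂ :=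
  analyticContinuation (fun z => zetaIntegral f M z w) {z : ℂ | (M : ℝ) < z.re}
    {z : ℂ | ∀ k : ℕ, 1 ≤ k → k ≤ M → z ≠ (k : ℂ)} s

/-- The generalized log-gamma function `L_M(w) = ∂_s ζ_M(s, w)` at `s = 0`, `Re w > 0`, continued
analytically in `w` to the complex plane without `(-∞, 0]`. -/
noncomputable def logGamma (f : ℂ → ℂ) (M : ℕ) : ℂ → ℂ :=
  analyticContinuation (fun w => deriv (fun s => zeta f M s w) 0) {w : ℂ | 0 < w.re}
    Complex.slitPlane

/-- The operator `S_N`: the alternating sum over all `p` and all `k_1 < ⋯ < k_p` in `{1, …, N}` of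
`F(q + b_0 + b_{k_1} + ⋯ + b_{k_p})`. -/
noncomputable def opS (N : ℕ) (b : ℕ → ℝ) (F : ℂ → ℂ) (q : ℂ) : ℂ :=
  ∑ p ∈ Finset.range (N + 1), (-1 : ℂ) ^ p *
    ∑ T ∈ Finset.powersetCard p (Finset.Icc 1 N), F (q + b 0 + ∑ k ∈ T, (b k : ℂ))

/-- The function `η_{M,N}(q | b)`, for `q` outside `(-∞, -b_0]`. -/
noncomputable def eta (f : ℂ → ℂ) (M N : ℕ) (b : ℕ → ℝ) (q : ℂ) : ℂ :=
  Complex.exp (opS N b (logGamma f M) q - opS N b (logGamma f M) 0)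

/-- `q → ∞` in the closed sector `|arg q| ≤ π - δ`. -/
noncomputable def sectorAtInfinity (δ : ℝ) : Filter ℂ :=
  Bornology.cobounded ℂ ⊓ 𝓟 {q : ℂ | |q.arg| ≤ Real.pi - δ}

end BarnesBeta

namespace BarnesBeta

/-! Write `f t = f 0 + t * g t` with `g = dslope f 0`, again of Ruijsenaars class. In the Mellin
transform of `e^{-wt} f(t)` divided by `Γ(u)`, the constant contributes `f 0 * w ^ (-u)` and the
factor `t` shifts `u` to `u + 1` (`mellinGamma_eq`). Iterating continues the transform to all `u`.
Differentiating at `s = 0` gives `L_M[f] = f(0) * logTerm M + L_{M-1}[g]`, and at the bottom `L_0[f]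
= -f(0) log w` plus the Laplace transform of `g` (`hasDerivAt_zetaExt`). So `L_M` is a combination
of terms `w^m` and `w^m log w` with `m ≤ M`, plus one Laplace transform.

Turning the ray of integration by half the argument of `w` continues the Laplace transform to the
slit plane and shows that it tends to `0` in every sector (`tendsto_laplaceExt`).

`S_N` is an `N`-fold difference operator: it annihilates `w^m` for `m < N` and sends `w^N` to
`(-1)^N N! b_1 ⋯ b_N`. Expanding `log (q + c) = log q + log (1 + c / q)` shows that it sends `w^m
log w` to that same number times `log q`, plus a constant that is zero for `m < N`, plus `o(1)`
(`exists_tendsto_opS_pow_mul_log`). Hence everything tends to `0` if `M < N`. If `M = N`, only the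
top term survives, and the value of `1 / ((s - 1) ⋯ (s - N))` at `0` cancels `(-1)^N N!`. -/

theorem analyticContinuation_eqOn {g G : ℂ → ℂ} {S U : Set ℂ} (hS : IsOpen S) (hne : S.Nonempty)
    (hSU : S ⊆ U) (hU : IsPreconnected U) (hG : IsAnalyticContinuation g S U G) :
    Set.EqOn (analyticContinuation g S U) G U := by
  have h : ∃ G : ℂ → ℂ, IsAnalyticContinuation g S U G := ⟨G, hG⟩
  have hc : IsAnalyticContinuation g S U (analyticContinuation g S U) := by
    rw [analyticContinuation, dif_pos h]
    exact h.choose_spec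
  obtain ⟨z, hz⟩ := hne
  refine hc.1.eqOn_of_preconnected_of_eventuallyEq hG.1 hU (hSU hz) ?_
  filter_upwards [hS.mem_nhds hz] with x hx
  rw [hc.2 hx, hG.2 hx]

/-! ### The Ruijsenaars class: removing the constant term, bounds on cones. -/

namespace RuijsenaarsClass

variable {f : ℂ → ℂ}

theorem eq_add_mul_dslope (f : ℂ → ℂ) (t : ℂ) : f t = f 0 + t * dslope f 0 t := by
  have := sub_smul_dslope f 0 t
  rw [sub_zero, smul_eq_mul] at this
  rw [this]; ring

/-- The singularity of `(f t - f 0) / t` at `0` is removable, and division by `t` does not increase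
growth once `1 ≤ ‖t‖`. Every recursion below rests on this closure property. -/
theorem dslope_zero (hf : RuijsenaarsClass f) : RuijsenaarsClass (dslope f 0) := by
  have hd : AnalyticOnNhd ℂ (dslope f 0) {x | AnalyticAt ℂ f x} := by
    refine DifferentiableOn.analyticOnNhd ?_ (isOpen_analyticAt ℂ f)
    rw [Complex.differentiableOn_dslope ((isOpen_analyticAt ℂ f).mem_nhds hf.analytic_zero)]
    exact fun x hx => (AnalyticAt.differentiableAt hx).differentiableWithinAt
  refine ⟨fun t ht => hd t (hf.analytic_right t ht), hd 0 hf.analytic_zero, fun χ hχ => ?_⟩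
  obtain ⟨k, hk⟩ := hf.growth χ hχ
  refine ⟨k, ?_⟩
  have hlarge : ∀ᶠ t : ℂ in Bornology.cobounded ℂ ⊓ 𝓟 {t : ℂ | |t.arg| ≤ χ}, 1 ≤ ‖t‖ :=
    (tendsto_norm_cobounded_atTop.eventually_ge_atTop 1).filter_mono inf_le_left
  have h1 : (fun t => f t - f 0) =O[Bornology.cobounded ℂ ⊓ 𝓟 {t : ℂ | |t.arg| ≤ χ}]
      fun t : ℂ => ‖t‖ ^ k := by
    refine hk.sub (Asymptotics.IsBigO.of_bound ‖f 0‖ ?_)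
    filter_upwards [hlarge] with t ht
    have : (1 : ℝ) ≤ ‖t‖ ^ k := one_le_pow₀ ht
    rw [Real.norm_of_nonneg (by positivity)]
    nlinarith [norm_nonneg (f 0)]
  refine Asymptotics.IsBigO.trans (Asymptotics.IsBigO.of_bound 1 ?_) h1
  filter_upwards [hlarge] with t ht
  have := sub_smul_dslope f 0 t
  rw [← this, sub_zero, smul_eq_mul, norm_mul, one_mul]
  nlinarith [norm_nonneg (dslope f 0 t)]

/-- The cone is the sector `|arg t| ≤ arccos c` with its apex, written as a closed condition. The
growth hypothesis covers large `t`; the rest is compact, with analyticity at `0` giving continuity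
at the apex. -/
theorem exists_bound (hf : RuijsenaarsClass f) {c : ℝ} (hc : 0 < c) :
    ∃ C : ℝ, 0 ≤ C ∧ ∃ k : ℕ, ∀ t : ℂ, c * ‖t‖ ≤ t.re → ‖f t‖ ≤ C * (1 + ‖t‖) ^ k := by
  obtain ⟨k, hk⟩ := hf.growth (Real.arccos c) (Real.arccos_lt_pi_div_two.2 hc)
  obtain ⟨C₁, hC₁, h₁⟩ := hk.exists_pos
  rw [Asymptotics.isBigOWith_iff, eventually_inf_principal] at h₁
  obtain ⟨R, -, hR⟩ := (hasBasis_cobounded_norm (E := ℂ)).eventually_iff.1 h₁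
  set K : Set ℂ := {t : ℂ | c * ‖t‖ ≤ t.re} ∩ Metric.closedBall 0 R with hK
  have hKc : IsCompact K := by
    refine (isCompact_closedBall 0 R).inter_left ?_
    exact isClosed_le (by fun_prop) Complex.continuous_re
  have hcont : ContinuousOn f K := by
    intro t ht
    rcases eq_or_ne t 0 with rfl | h0
    · exact hf.analytic_zero.continuousAt.continuousWithinAt
    · refine (hf.analytic_right t ?_).continuousAt.continuousWithinAt
      exact lt_of_lt_of_le (mul_pos hc (norm_pos_iff.2 h0)) ht.1
  obtain ⟨C₂, hC₂⟩ := hKc.exists_bound_of_continuousOn hcont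
  refine ⟨max C₁ C₂, le_max_of_le_left hC₁.le, k, fun t ht => ?_⟩
  have hone : (1 : ℝ) ≤ (1 + ‖t‖) ^ k := one_le_pow₀ (by linarith [norm_nonneg t])
  have hmax : 0 ≤ max C₁ C₂ := le_max_of_le_left hC₁.le
  rcases le_total ‖t‖ R with hle | hle
  · have := hC₂ t ⟨ht, by simpa using hle⟩
    nlinarith [le_max_right C₁ C₂]
  · have harg : |t.arg| ≤ Real.arccos c := by
      rcases eq_or_ne t 0 with rfl | h0
      · simpa using Real.arccos_nonneg c
      · rw [← Real.arccos_cos (abs_nonneg t.arg) (Complex.abs_arg_le_pi t), Real.cos_abs,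
          Complex.cos_arg h0]
        exact Real.arccos_le_arccos ((le_div_iff₀ (norm_pos_iff.2 h0)).2 ht)
    have h := hR hle harg
    rw [Real.norm_of_nonneg (by positivity)] at h
    calc ‖f t‖ ≤ C₁ * ‖t‖ ^ k := h
      _ ≤ max C₁ C₂ * (1 + ‖t‖) ^ k := by
        gcongr
        · exact le_max_left _ _
        · linarith

end RuijsenaarsClass

/-! ### Integrals depending holomorphically on a parameter. -/

theorem isLittleO_one_add_pow_exp (k : ℕ) {c : ℝ} (hc : 0 < c) :
    (fun r : ℝ => (1 + r) ^ k) =o[atTop] fun r => Real.exp (c * r) := by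
  have h := (isLittleO_pow_exp_pos_mul_atTop k hc).comp_tendsto
    (tendsto_atTop_add_const_left atTop (1 : ℝ) tendsto_id)
  refine h.trans_isBigO (Asymptotics.IsBigO.of_bound (Real.exp c) ?_)
  refine Eventually.of_forall fun r => ?_
  simp only [Function.comp, id, Real.norm_eq_abs, Real.abs_exp]
  rw [← Real.exp_add]
  exact le_of_eq (by ring_nf)

theorem integrableOn_one_add_pow_mul_exp (C : ℝ) (k : ℕ) {c : ℝ} (hc : 0 < c) :
    MeasureTheory.IntegrableOn (fun r : ℝ => C * (1 + r) ^ k * Real.exp (-c * r))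
      (Set.Ioi 0) := by
  refine integrable_of_isBigO_exp_neg (b := c / 2) (by positivity) (by fun_prop) ?_
  have h := isLittleO_one_add_pow_exp k (half_pos hc)
  have h2 := (h.isBigO.const_mul_left C).mul
    (Asymptotics.isBigO_refl (fun r : ℝ => Real.exp (-c * r)) atTop)
  refine h2.congr_right fun r => ?_
  rw [← Real.exp_add]
  ring_nf

/-- A parametric integral over `(0, ∞)` of functions holomorphic in the parameter, locally
uniformly dominated by an integrable function, is holomorphic. -/
theorem differentiableOn_integral_Ioi {U : Set ℂ} (hU : IsOpen U) {F : ℂ → ℝ → ℂ}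
    (hF : ∀ r : ℝ, 0 < r → DifferentiableOn ℂ (fun v => F v r) U)
    (hFc : ∀ v ∈ U, ContinuousOn (F v) (Set.Ioi 0))
    (hb : ∀ v₀ ∈ U, ∃ B : ℝ → ℝ, MeasureTheory.IntegrableOn B (Set.Ioi 0) ∧
      ∀ᶠ v in 𝓝 v₀, ∀ r : ℝ, 0 < r → ‖F v r‖ ≤ B r) :
    DifferentiableOn ℂ (fun v => ∫ r in Set.Ioi (0 : ℝ), F v r) U := by
  intro v₀ hv₀
  obtain ⟨B, hB, hev⟩ := hb v₀ hv₀
  obtain ⟨ε, hε, hball⟩ := Metric.eventually_nhds_iff_ball.1 (hev.and (hU.mem_nhds hv₀))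
  have hmeas : ∀ v ∈ U, MeasureTheory.AEStronglyMeasurable (F v)
      (MeasureTheory.volume.restrict (Set.Ioi 0)) := fun v hv =>
    (hFc v hv).aestronglyMeasurable measurableSet_Ioi
  have hdiff : ∀ r : ℝ, 0 < r → ∀ v ∈ U, HasDerivAt (fun v => F v r) (deriv (fun v => F v r) v) v :=
    fun r hr v hv => ((hF r hr).differentiableAt (hU.mem_nhds hv)).hasDerivAt
  have hsub : ∀ v ∈ Metric.ball v₀ (ε / 2), Metric.closedBall v (ε / 4) ⊆ Metric.ball v₀ ε := by
    intro v hv x hx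
    have h1 := Metric.mem_ball.1 hv
    have h2 := Metric.mem_closedBall.1 hx
    exact Metric.mem_ball.2 (by linarith [dist_triangle x v v₀])
  refine (hasDerivAt_integral_of_dominated_loc_of_deriv_le (𝕜 := ℂ) (F := F)
    (F' := fun v r => deriv (fun v => F v r) v)
    (bound := fun r => B r / (ε / 4)) (Metric.ball_mem_nhds v₀ (half_pos hε)) ?_ ?_ ?_ ?_
    (hB.div_const _) ?_).2.differentiableAt.differentiableWithinAt
  · filter_upwards [hU.mem_nhds hv₀] with v hv using hmeas v hv
  · refine MeasureTheory.Integrable.mono' hB (hmeas v₀ hv₀) ?_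
    filter_upwards [MeasureTheory.ae_restrict_mem measurableSet_Ioi] with r hr
    exact (hball v₀ (Metric.mem_ball_self hε)).1 r hr
  -- The derivative in the parameter is measurable in `r` as a pointwise limit of difference
  -- quotients along a real sequence decreasing to `0`.
  · obtain ⟨u, -, hu, hulim⟩ := exists_seq_strictAnti_tendsto' (half_pos hε)
    refine aestronglyMeasurable_of_tendsto_ae atTop
      (f := fun (n : ℕ) (r : ℝ) => ((u n : ℂ))⁻¹ * (F (v₀ + u n) r - F v₀ r)) ?_ ?_
    · intro n
      refine ((hmeas _ (hball _ ?_).2).sub (hmeas v₀ hv₀)).const_mul _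
      have := hu n
      simp only [Metric.mem_ball, dist_self_add_left, Complex.norm_real, Real.norm_eq_abs]
      rw [abs_of_pos this.1]
      linarith [this.2]
    · filter_upwards [MeasureTheory.ae_restrict_mem measurableSet_Ioi] with r hr
      have h := (hasDerivAt_iff_tendsto_slope_zero.1 (hdiff r hr v₀ hv₀))
      refine h.comp (tendsto_nhdsWithin_iff.2 ⟨?_, ?_⟩)
      · exact (Complex.continuous_ofReal.tendsto' 0 0 (by simp)).comp hulim
      · exact Eventually.of_forall fun n => by simpa using (hu n).1.ne'
  · filter_upwards [MeasureTheory.ae_restrict_mem measurableSet_Ioi] with r hr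
    intro v hv
    -- Cauchy's estimate on the circle of radius `ε / 4`, which stays in the ball where `B`
    -- dominates.
    refine Complex.norm_deriv_le_of_forall_mem_sphere_norm_le (by positivity) ?_ ?_
    · refine DifferentiableOn.diffContOnCl ((hF r hr).mono ?_)
      rw [closure_ball _ (by positivity)]
      exact fun x hx => (hball x (hsub v hv hx)).2
    · intro z hz
      exact (hball z (hsub v hv (Metric.sphere_subset_closedBall hz))).1 r hr
  · filter_upwards [MeasureTheory.ae_restrict_mem measurableSet_Ioi] with r hr
    intro v hv
    exact hdiff r hr v (hball v (hsub v hv (Metric.mem_closedBall_self (by positivity)))).2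

theorem isOpen_re_pos : IsOpen {w : ℂ | 0 < w.re} := isOpen_lt continuous_const Complex.continuous_re

/-- Identity theorem on the right half-plane, for functions agreeing on the positive reals. -/
theorem eqOn_re_pos_of_eq_ofReal {F G : ℂ → ℂ} (hF : DifferentiableOn ℂ F {w : ℂ | 0 < w.re})
    (hG : DifferentiableOn ℂ G {w : ℂ | 0 < w.re})
    (h : ∀ x : ℝ, 0 < x → F x = G x) : Set.EqOn F G {w : ℂ | 0 < w.re} := by
  refine (hF.analyticOnNhd isOpen_re_pos).eqOn_of_preconnected_of_frequently_eq
    (hG.analyticOnNhd isOpen_re_pos) (convex_halfSpace_re_gt 0).isPreconnected (z₀ := 1)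
    (by simp) ?_
  obtain ⟨u, -, hu, hulim⟩ := exists_seq_strictAnti_tendsto (1 : ℝ)
  have ht : Tendsto (fun n => (u n : ℂ)) atTop (𝓝[≠] 1) := by
    refine tendsto_nhdsWithin_iff.2 ⟨?_, ?_⟩
    · exact (Complex.continuous_ofReal.tendsto' 1 1 (by simp)).comp hulim
    · exact Eventually.of_forall fun n => by
        simpa using (hu n).ne'
  exact ht.frequently (Eventually.of_forall fun n => h _ (by linarith [hu n])).frequently

theorem mellin_exp_neg_mul {u w : ℂ} (hu : 0 < u.re) (hw : 0 < w.re) :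
    mellin (fun t : ℝ => Complex.exp (-w * t)) u = w ^ (-u) * Complex.Gamma u := by
  refine eqOn_re_pos_of_eq_ofReal
    (F := fun w => mellin (fun t : ℝ => Complex.exp (-w * t)) u)
    (G := fun w => w ^ (-u) * Complex.Gamma u) ?_ ?_ ?_ hw
  · refine differentiableOn_integral_Ioi isOpen_re_pos ?_ ?_ ?_
    · intro r hr
      fun_prop
    · intro v hv
      refine ContinuousOn.mul (fun t ht => ?_)
        (by fun_prop : Continuous fun t : ℝ => Complex.exp (-v * t)).continuousOn
      exact (Complex.continuousAt_ofReal_cpow_const t _ (Or.inr (ne_of_gt ht))).continuousWithinAt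
    · intro v₀ hv₀
      have hv₀' : 0 < v₀.re := hv₀
      refine ⟨fun t => t ^ (u.re - 1) * Real.exp (-(v₀.re / 2) * t ^ (1 : ℝ)), ?_, ?_⟩
      · exact integrableOn_rpow_mul_exp_neg_mul_rpow (by linarith) one_pos (by linarith)
      · have : ∀ᶠ v : ℂ in 𝓝 v₀, v₀.re / 2 < v.re :=
          Complex.continuous_re.continuousAt.eventually (lt_mem_nhds (by linarith))
        filter_upwards [this] with v hv r hr
        rw [norm_smul, Complex.norm_cpow_eq_rpow_re_of_pos hr, Complex.norm_exp, Real.rpow_one]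
        simp only [Complex.sub_re, Complex.one_re, Complex.neg_re,
          Complex.re_mul_ofReal, neg_mul]
        gcongr
  · intro v hv
    have : v ∈ Complex.slitPlane := Or.inl hv
    exact ((differentiableAt_id.cpow_const this).mul_const _).differentiableWithinAt
  · intro x hx
    have := Complex.integral_cpow_mul_exp_neg_mul_Ioi hu hx
    simp only [mellin, smul_eq_mul, neg_mul]
    rw [this, one_div, Complex.inv_cpow _ _ (by
      rw [Complex.arg_ofReal_of_nonneg hx.le]; exact Real.pi_pos.ne), Complex.cpow_neg]

/-! ### The normalised Mellin transform and its entire continuation. -/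

section

variable {f : ℂ → ℂ}

theorem RuijsenaarsClass.continuousOn_Ioi (hf : RuijsenaarsClass f) :
    ContinuousOn (fun t : ℝ => f t) (Set.Ioi 0) := fun t ht =>
  ((hf.analytic_right (t : ℂ) (by simpa using ht)).continuousAt.comp
    Complex.continuous_ofReal.continuousAt).continuousWithinAt

theorem RuijsenaarsClass.exists_bound_Ioi (hf : RuijsenaarsClass f) :
    ∃ C : ℝ, 0 ≤ C ∧ ∃ k : ℕ, ∀ t : ℝ, 0 < t → ‖f t‖ ≤ C * (1 + t) ^ k := by
  obtain ⟨C, hC, k, h⟩ := hf.exists_bound one_pos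
  refine ⟨C, hC, k, fun t ht => ?_⟩
  simpa [abs_of_pos ht] using h t (by simp [abs_of_pos ht])

theorem RuijsenaarsClass.isBigO_exp_atTop (hf : RuijsenaarsClass f) {w : ℂ} (hw : 0 < w.re) :
    (fun t : ℝ => Complex.exp (-w * t) * f t) =O[atTop] fun t => Real.exp (-(w.re / 2) * t) := by
  obtain ⟨C, hC, k, h⟩ := hf.exists_bound_Ioi
  have h1 := isLittleO_one_add_pow_exp k (half_pos hw)
  have h2 : (fun t : ℝ => f t) =O[atTop] fun r => Real.exp (w.re / 2 * r) := by
    refine Asymptotics.IsBigO.trans (Asymptotics.IsBigO.of_bound C ?_) h1.isBigO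
    filter_upwards [eventually_gt_atTop 0] with t ht
    rw [Real.norm_of_nonneg (by positivity)]
    exact h t ht
  have h3 : (fun t : ℝ => Complex.exp (-w * t)) =O[atTop] fun t => Real.exp (-w.re * t) :=
    Asymptotics.IsBigO.of_bound 1 (Eventually.of_forall fun t => by
      simp [Complex.norm_exp])
  refine (h3.mul h2).congr_right fun t => ?_
  rw [← Real.exp_add]
  ring_nf

theorem RuijsenaarsClass.isBigO_zero (hf : RuijsenaarsClass f) (w : ℂ) :
    (fun t : ℝ => Complex.exp (-w * t) * f t) =O[𝓝[>] 0] fun t : ℝ => t ^ (-(0 : ℝ)) := by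
  have h : ContinuousAt (fun t : ℝ => Complex.exp (-w * t) * f t) 0 := by
    refine ContinuousAt.mul (by fun_prop) ?_
    refine ContinuousAt.comp (g := f) ?_ Complex.continuous_ofReal.continuousAt
    simpa using hf.analytic_zero.continuousAt
  have := (h.tendsto.isBigO_one ℝ).mono (nhdsWithin_le_nhds (s := Set.Ioi 0))
  simpa using this

theorem RuijsenaarsClass.locallyIntegrableOn (hf : RuijsenaarsClass f) (w : ℂ) :
    MeasureTheory.LocallyIntegrableOn (fun t : ℝ => Complex.exp (-w * t) * f t) (Set.Ioi 0) :=
  (ContinuousOn.mul (by fun_prop) hf.continuousOn_Ioi).locallyIntegrableOn measurableSet_Ioi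

/-- The Mellin transform of `e^{-wt} f(t)`, normalised by `1 / Γ(u)`. -/
noncomputable def mellinGamma (f : ℂ → ℂ) (u w : ℂ) : ℂ :=
  (Complex.Gamma u)⁻¹ * mellin (fun t : ℝ => Complex.exp (-w * t) * f t) u

theorem differentiableAt_mellinGamma (hf : RuijsenaarsClass f) {u w : ℂ} (hu : 0 < u.re)
    (hw : 0 < w.re) : DifferentiableAt ℂ (fun u => mellinGamma f u w) u :=
  (Complex.differentiable_one_div_Gamma u).mul
    (mellin_differentiableAt_of_isBigO_rpow_exp (half_pos hw) (hf.locallyIntegrableOn w)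
      (hf.isBigO_exp_atTop hw) (hf.isBigO_zero w) hu)

theorem mellinConvergent_exp_mul (hf : RuijsenaarsClass f) {u w : ℂ} (hu : 0 < u.re)
    (hw : 0 < w.re) : MellinConvergent (fun t : ℝ => Complex.exp (-w * t) * f t) u :=
  mellinConvergent_of_isBigO_rpow_exp (half_pos hw) (hf.locallyIntegrableOn w)
      (hf.isBigO_exp_atTop hw) (hf.isBigO_zero w) hu

theorem ruijsenaarsClass_one : RuijsenaarsClass (fun _ => 1) :=
  ⟨fun _ _ => analyticAt_const, analyticAt_const, fun _ _ => ⟨0, by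
    simpa using Asymptotics.isBigO_const_const (1 : ℂ) (one_ne_zero (α := ℝ)) _⟩⟩

/-- Split `f t = f 0 + t * dslope f 0 t`; the factor `t` raises the Mellin variable by one, and `Γ(u
+ 1) = u Γ(u)` adjusts the normalisation. The right side is meaningful for `Re u > -1`, so each use
gains a strip of width one. -/
theorem mellinGamma_eq (hf : RuijsenaarsClass f) {u w : ℂ} (hu : 0 < u.re) (hw : 0 < w.re) :
    mellinGamma f u w = f 0 * w ^ (-u) + u * mellinGamma (dslope f 0) (u + 1) w := by
  have hu0 : u ≠ 0 := by rintro rfl; simp at hu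
  have hG := Complex.Gamma_ne_zero_of_re_pos hu
  have hone : MellinConvergent (fun t : ℝ => Complex.exp (-w * t)) u := by
    simpa using mellinConvergent_exp_mul ruijsenaarsClass_one hu hw
  have h1 := mellinConvergent_exp_mul hf.dslope_zero (u := u + 1) (by simp; linarith) hw
  have key : mellin (fun t : ℝ => Complex.exp (-w * t) * f t) u
      = f 0 * mellin (fun t : ℝ => Complex.exp (-w * t)) u
        + mellin (fun t : ℝ => Complex.exp (-w * t) * dslope f 0 t) (u + 1) := by
    simp only [mellin]
    rw [← MeasureTheory.integral_const_mul, ← MeasureTheory.integral_add (hone.const_mul _) h1]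
    refine MeasureTheory.setIntegral_congr_fun measurableSet_Ioi fun t ht => ?_
    have ht0 : (t : ℂ) ≠ 0 := by exact_mod_cast (ne_of_gt ht)
    simp only [smul_eq_mul]
    rw [RuijsenaarsClass.eq_add_mul_dslope f t, add_sub_cancel_right,
      show (t : ℂ) ^ u = (t : ℂ) ^ (u - 1) * t by
        rw [Complex.cpow_sub _ _ ht0, Complex.cpow_one]; field_simp]
    ring
  rw [mellinGamma, mellinGamma, key, mellin_exp_neg_mul hu hw, Complex.Gamma_add_one _ hu0]
  field_simp

/-- The continuation of `mellinGamma f` to `Re u > -n`. -/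
noncomputable def mellinGammaAux : ℕ → (ℂ → ℂ) → ℂ → ℂ → ℂ
  | 0, f, u, w => mellinGamma f u w
  | n + 1, f, u, w => f 0 * w ^ (-u) + u * mellinGammaAux n (dslope f 0) (u + 1) w

theorem mellinGammaAux_succ_eq (n : ℕ) : ∀ {f : ℂ → ℂ}, RuijsenaarsClass f → ∀ {u w : ℂ},
    -(n : ℝ) < u.re → 0 < w.re → mellinGammaAux (n + 1) f u w = mellinGammaAux n f u w := by
  induction n with
  | zero =>
    intro f hf u w hu hw
    exact (mellinGamma_eq hf (by simpa using hu) hw).symm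
  | succ n ih =>
    intro f hf u w hu hw
    rw [mellinGammaAux, ih hf.dslope_zero (by push_cast at hu; simp; linarith) hw, mellinGammaAux]

theorem mellinGammaAux_eq_of_le {n m : ℕ} (hnm : n ≤ m) {f : ℂ → ℂ} (hf : RuijsenaarsClass f)
    {u w : ℂ} (hu : -(n : ℝ) < u.re) (hw : 0 < w.re) :
    mellinGammaAux m f u w = mellinGammaAux n f u w := by
  induction m, hnm using Nat.le_induction with
  | base => rfl
  | succ m hm ih =>
    rw [mellinGammaAux_succ_eq m hf _ hw, ih]
    have : (n : ℝ) ≤ m := by exact_mod_cast hm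
    linarith

theorem differentiableAt_mellinGammaAux (n : ℕ) : ∀ {f : ℂ → ℂ}, RuijsenaarsClass f → ∀ {u w : ℂ},
    -(n : ℝ) < u.re → 0 < w.re → DifferentiableAt ℂ (fun u => mellinGammaAux n f u w) u := by
  induction n with
  | zero =>
    intro f hf u w hu hw
    exact differentiableAt_mellinGamma hf (by simpa using hu) hw
  | succ n ih =>
    intro f hf u w hu hw
    have hw0 : w ≠ 0 := by rintro rfl; simp at hw
    have h := ih hf.dslope_zero (u := u + 1) (by push_cast at hu; simp; linarith) hw
    refine DifferentiableAt.add ?_ (differentiableAt_id.mul ?_)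
    · exact (differentiableAt_id.neg.const_cpow (Or.inl hw0)).const_mul _
    · exact h.comp u (differentiableAt_id.add_const 1)

/-- The entire continuation of `u ↦ mellinGamma f u w`. -/
noncomputable def mellinGammaExt (f : ℂ → ℂ) (u w : ℂ) : ℂ :=
  -- Any index `n` with `-n < Re u` gives the same value; this choice always qualifies.
  mellinGammaAux (⌊|u.re|⌋₊ + 1) f u w

theorem mellinGammaExt_eq (hf : RuijsenaarsClass f) {n : ℕ} {u w : ℂ} (hu : -(n : ℝ) < u.re)
    (hw : 0 < w.re) : mellinGammaExt f u w = mellinGammaAux n f u w := by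
  have h : -((⌊|u.re|⌋₊ + 1 : ℕ) : ℝ) < u.re := by
    have := Nat.lt_floor_add_one |u.re|
    push_cast
    linarith [neg_abs_le u.re]
  rw [mellinGammaExt]
  rcases le_total n (⌊|u.re|⌋₊ + 1) with hle | hle
  · exact mellinGammaAux_eq_of_le hle hf hu hw
  · exact (mellinGammaAux_eq_of_le hle hf h hw).symm

theorem differentiable_mellinGammaExt (hf : RuijsenaarsClass f) {w : ℂ} (hw : 0 < w.re) :
    Differentiable ℂ fun u => mellinGammaExt f u w := by
  intro u
  obtain ⟨n, hn⟩ := exists_nat_gt (-u.re)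
  refine (differentiableAt_mellinGammaAux n hf (by linarith) hw).congr_of_eventuallyEq ?_
  have : ∀ᶠ v : ℂ in 𝓝 u, -(n : ℝ) < v.re :=
    Complex.continuous_re.continuousAt.eventually (lt_mem_nhds (by linarith))
  filter_upwards [this] with v hv using mellinGammaExt_eq hf hv hw

theorem mellinGammaExt_eq_mellinGamma (hf : RuijsenaarsClass f) {u w : ℂ} (hu : 0 < u.re)
    (hw : 0 < w.re) : mellinGammaExt f u w = mellinGamma f u w :=
  mellinGammaExt_eq (n := 0) hf (by simpa using hu) hw

theorem mellinGammaExt_recursion (hf : RuijsenaarsClass f) (u : ℂ) {w : ℂ} (hw : 0 < w.re) :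
    mellinGammaExt f u w = f 0 * w ^ (-u) + u * mellinGammaExt (dslope f 0) (u + 1) w := by
  obtain ⟨n, hn⟩ := exists_nat_gt (-u.re)
  rw [mellinGammaExt_eq (n := n + 1) hf (by push_cast; linarith) hw, mellinGammaAux,
    mellinGammaExt_eq (n := n) hf.dslope_zero (by simp; linarith) hw]

end

/-- The Laplace transform of `f`. -/
noncomputable def laplace (f : ℂ → ℂ) (w : ℂ) : ℂ :=
  ∫ t in Set.Ioi (0 : ℝ), Complex.exp (-w * t) * f t

/-- The Laplace transform of `f` at `v ^ 2`, along the ray `r ↦ r / v`. -/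
noncomputable def laplaceRay (f : ℂ → ℂ) (v : ℂ) : ℂ :=
  v⁻¹ * ∫ r in Set.Ioi (0 : ℝ), Complex.exp (-v * r) * f (r / v)

/-- The continuation of the Laplace transform of `f` to the slit plane. -/
noncomputable def laplaceExt (f : ℂ → ℂ) (w : ℂ) : ℂ :=
  laplaceRay f (Complex.exp (Complex.log w / 2))

/-! ### The Laplace transform on the slit plane and its decay in sectors. -/

section

variable {f : ℂ → ℂ}

theorem mellinGamma_one (f : ℂ → ℂ) (w : ℂ) : mellinGamma f 1 w = laplace f w := by
  simp [mellinGamma, laplace, mellin]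

theorem differentiableOn_laplace (hf : RuijsenaarsClass f) :
    DifferentiableOn ℂ (laplace f) {w : ℂ | 0 < w.re} := by
  obtain ⟨C, hC, k, h⟩ := hf.exists_bound_Ioi
  refine differentiableOn_integral_Ioi isOpen_re_pos (fun r hr => by fun_prop) ?_ ?_
  · intro v hv
    exact (by fun_prop : Continuous fun t : ℝ => Complex.exp (-v * t)).continuousOn.mul
      hf.continuousOn_Ioi
  · intro v₀ hv₀
    have hv₀' : 0 < v₀.re := hv₀
    refine ⟨_, integrableOn_one_add_pow_mul_exp C k (half_pos hv₀'), ?_⟩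
    have : ∀ᶠ v : ℂ in 𝓝 v₀, v₀.re / 2 < v.re :=
      Complex.continuous_re.continuousAt.eventually (lt_mem_nhds (by linarith))
    filter_upwards [this] with v hv r hr
    rw [norm_mul, Complex.norm_exp, mul_comm]
    simp only [Complex.neg_re, Complex.re_mul_ofReal, neg_mul]
    gcongr
    exact h r hr

/-- The point `r / v` has the direction of the conjugate of `v`, so it lies in the same symmetric
cone and the bound on `f` applies. The majorant depends on `v` only through `m`. -/
theorem norm_exp_mul_comp_div_le {C c m : ℝ} {k : ℕ} (hm : 0 < m) (hC : 0 ≤ C)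
    (h : ∀ t : ℂ, c * ‖t‖ ≤ t.re → ‖f t‖ ≤ C * (1 + ‖t‖) ^ k) {v : ℂ} (hcv : c * ‖v‖ ≤ v.re)
    (hmv : m ≤ v.re) {r : ℝ} (hr : 0 < r) :
    ‖Complex.exp (-v * r) * f (r / v)‖
      ≤ C * (1 + m⁻¹) ^ k * (1 + r) ^ k * Real.exp (-m * r) := by
  have hv : 0 < ‖v‖ := hm.trans_le (hmv.trans (Complex.re_le_norm v))
  have hn : ‖(r / v : ℂ)‖ = r / ‖v‖ := by
    rw [norm_div, Complex.norm_real, Real.norm_of_nonneg hr.le]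
  have hre : (r / v : ℂ).re = r * v.re / ‖v‖ ^ 2 := by
    rw [Complex.div_re, Complex.normSq_eq_norm_sq]
    simp
  have h1 : ‖f (r / v)‖ ≤ C * (1 + r / ‖v‖) ^ k := by
    rw [← hn]
    refine h _ ?_
    rw [hn, hre, ← mul_div_assoc, div_le_div_iff₀ hv (by positivity)]
    have := mul_le_mul_of_nonneg_left hcv (by positivity : 0 ≤ r * ‖v‖)
    nlinarith
  have h2 : 1 + r / ‖v‖ ≤ (1 + m⁻¹) * (1 + r) := by
    have : r / ‖v‖ ≤ m⁻¹ * r := by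
      rw [div_eq_inv_mul]
      have : m ≤ ‖v‖ := hmv.trans (Complex.re_le_norm v)
      gcongr
    have := inv_pos.2 hm
    nlinarith
  rw [norm_mul, Complex.norm_exp, mul_comm]
  simp only [Complex.neg_re, Complex.re_mul_ofReal, neg_mul]
  calc ‖f (r / v)‖ * Real.exp (-(v.re * r))
      ≤ C * ((1 + m⁻¹) * (1 + r)) ^ k * Real.exp (-(m * r)) := by
        gcongr
        exact h1.trans (by gcongr)
    _ = _ := by rw [mul_pow]; ring

theorem re_div_pos {v : ℂ} (hv : 0 < v.re) {r : ℝ} (hr : 0 < r) : 0 < (r / v : ℂ).re := by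
  have hv0 : v ≠ 0 := by rintro rfl; simp at hv
  rw [Complex.div_re]
  have := Complex.normSq_pos.2 hv0
  simp
  positivity

theorem differentiableOn_laplaceRay (hf : RuijsenaarsClass f) :
    DifferentiableOn ℂ (laplaceRay f) {v : ℂ | 0 < v.re} := by
  have hne : ∀ v ∈ {v : ℂ | 0 < v.re}, v ≠ 0 := by
    rintro v hv rfl
    simp at hv
  refine DifferentiableOn.mul (differentiableOn_id.inv hne) ?_
  refine differentiableOn_integral_Ioi isOpen_re_pos ?_ ?_ ?_
  · intro r hr v hv
    refine DifferentiableAt.differentiableWithinAt ?_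
    refine DifferentiableAt.mul (by fun_prop) ?_
    exact DifferentiableAt.comp v (hf.analytic_right _ (re_div_pos hv hr)).differentiableAt
      ((differentiableAt_const _).div differentiableAt_id (hne v hv))
  · intro v hv
    refine ContinuousOn.mul
      (by fun_prop : Continuous fun t : ℝ => Complex.exp (-v * t)).continuousOn ?_
    intro r hr
    refine ContinuousAt.continuousWithinAt (ContinuousAt.comp (g := f)
      (hf.analytic_right _ (re_div_pos hv hr)).continuousAt ?_)
    exact Complex.continuous_ofReal.continuousAt.div_const v
  · intro v₀ hv₀
    have hv₀' : 0 < v₀.re := hv₀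
    have hn : 0 < ‖v₀‖ := hv₀'.trans_le (Complex.re_le_norm v₀)
    have hc : 0 < v₀.re / 2 / (2 * ‖v₀‖) := by positivity
    obtain ⟨C, hC, k, h⟩ := hf.exists_bound hc
    refine ⟨_, integrableOn_one_add_pow_mul_exp (C * (1 + (v₀.re / 2)⁻¹) ^ k) k (half_pos hv₀'), ?_⟩
    have h1 : ∀ᶠ v : ℂ in 𝓝 v₀, v₀.re / 2 < v.re :=
      Complex.continuous_re.continuousAt.eventually (lt_mem_nhds (by linarith))
    have h2 : ∀ᶠ v : ℂ in 𝓝 v₀, ‖v‖ < 2 * ‖v₀‖ :=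
      continuous_norm.continuousAt.eventually (gt_mem_nhds (by linarith))
    filter_upwards [h1, h2] with v hv1 hv2 r hr
    refine norm_exp_mul_comp_div_le (half_pos hv₀') hC h ?_ hv1.le hr
    refine le_trans ?_ hv1.le
    rw [div_mul_eq_mul_div, div_le_iff₀ (by positivity)]
    gcongr

theorem re_exp_log_half_pos {w : ℂ} (hw : w ∈ Complex.slitPlane) :
    0 < (Complex.exp (Complex.log w / 2)).re := by
  have h := Complex.mem_slitPlane_iff_arg.1 hw
  have h1 : |w.arg| < Real.pi := lt_of_le_of_ne (Complex.abs_arg_le_pi w) fun h' => by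
    rcases (abs_eq Real.pi_pos.le).1 h' with h'' | h''
    · exact h.1 h''
    · exact (Complex.neg_pi_lt_arg w).ne' h''
  have him : (Complex.log w / 2).im = w.arg / 2 := by
    rw [show (2 : ℂ) = ((2 : ℝ) : ℂ) by norm_num, Complex.div_ofReal_im, Complex.log_im]
  rw [Complex.exp_re, him]
  have := abs_lt.1 h1
  exact mul_pos (Real.exp_pos _) (Real.cos_pos_of_mem_Ioo ⟨by linarith, by linarith⟩)

theorem differentiableOn_laplaceExt (hf : RuijsenaarsClass f) :
    DifferentiableOn ℂ (laplaceExt f) Complex.slitPlane :=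
  (differentiableOn_laplaceRay hf).comp
    (fun _ hw => ((Complex.differentiableAt_log hw).div_const 2).cexp.differentiableWithinAt)
    fun _ hw => re_exp_log_half_pos hw

/-- No contour rotation is needed: for `x > 0` the ray is the positive axis and the claim is the
substitution `t = r / √x`; the identity theorem does the rest. -/
theorem laplaceExt_eq (hf : RuijsenaarsClass f) :
    Set.EqOn (laplaceExt f) (laplace f) {w : ℂ | 0 < w.re} := by
  refine eqOn_re_pos_of_eq_ofReal
    ((differentiableOn_laplaceExt hf).mono fun w hw => Or.inl hw) (differentiableOn_laplace hf) ?_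
  intro x hx
  set y : ℝ := Real.exp (Real.log x / 2) with hy
  have hy0 : 0 < y := Real.exp_pos _
  have hyx : y * y = x := by
    rw [hy, ← Real.exp_add, add_halves, Real.exp_log hx]
  have hv : Complex.exp (Complex.log x / 2) = y := by
    rw [hy, ← Complex.ofReal_log hx.le]
    push_cast
    rfl
  rw [laplaceExt, hv, laplaceRay, laplace]
  have h := MeasureTheory.integral_comp_mul_left_Ioi
    (fun t : ℝ => Complex.exp (-x * t) * f t) 0 (inv_pos.2 hy0)
  rw [mul_zero, inv_inv, Complex.real_smul] at h
  rw [inv_mul_eq_iff_eq_mul₀ (by exact_mod_cast hy0.ne'), ← h]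
  refine MeasureTheory.setIntegral_congr_fun measurableSet_Ioi fun r _ => ?_
  have hyc : (y : ℂ) ≠ 0 := by exact_mod_cast hy0.ne'
  have hxc : (x : ℂ) = y * y := by exact_mod_cast hyx.symm
  simp only [hxc]
  push_cast
  congr 2
  · field_simp
  · rw [div_eq_inv_mul]

theorem sectorAtInfinity_le (δ : ℝ) : sectorAtInfinity δ ≤ Bornology.cobounded ℂ := inf_le_left

/-- In the sector, the square root `v` of `w` has argument at most `(π - δ) / 2`, so it stays in a
fixed cone. The ray integral is then bounded uniformly, and the prefactor `v⁻¹` gives decay of order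
`‖w‖ ^ (-1/2)`. -/
theorem tendsto_laplaceExt (hf : RuijsenaarsClass f) {δ : ℝ} (hδ : 0 < δ) :
    Tendsto (laplaceExt f) (sectorAtInfinity δ) (𝓝 0) := by
  -- Capping at `π` keeps `(π - ε) / 2` in `[0, π / 2)`, so that its cosine is positive even for
  -- large `δ`.
  set ε := min δ Real.pi with hε
  have hε0 : 0 < ε := lt_min hδ Real.pi_pos
  have hεπ : ε ≤ Real.pi := min_le_right _ _
  set c := Real.cos ((Real.pi - ε) / 2) with hcdef
  have hc : 0 < c := Real.cos_pos_of_mem_Ioo ⟨by linarith, by linarith⟩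
  obtain ⟨C, hC, k, h⟩ := hf.exists_bound hc
  set B := ∫ r in Set.Ioi (0 : ℝ), C * (1 + c⁻¹) ^ k * (1 + r) ^ k * Real.exp (-c * r) with hB
  have hnorm : ∀ w : ℂ, w ≠ 0 → ‖Complex.exp (Complex.log w / 2)‖ = Real.sqrt ‖w‖ := by
    intro w hw
    rw [Complex.norm_exp, show (2 : ℂ) = ((2 : ℝ) : ℂ) by norm_num, Complex.div_ofReal_re,
      Complex.log_re, Real.sqrt_eq_rpow, Real.rpow_def_of_pos (norm_pos_iff.2 hw)]
    ring_nf
  have hlim : Tendsto (fun w : ℂ => (Real.sqrt ‖w‖)⁻¹ * B) (sectorAtInfinity δ) (𝓝 0) := by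
    have h1 : Tendsto (fun w : ℂ => (Real.sqrt ‖w‖)⁻¹) (Bornology.cobounded ℂ) (𝓝 0) :=
      (Real.tendsto_sqrt_atTop.comp tendsto_norm_cobounded_atTop).inv_tendsto_atTop
    simpa using (h1.mul_const B).mono_left (sectorAtInfinity_le δ)
  refine squeeze_zero_norm' ?_ hlim
  rw [sectorAtInfinity, eventually_inf_principal]
  filter_upwards [tendsto_norm_cobounded_atTop.eventually_ge_atTop 1] with w hw harg
  have hw0 : w ≠ 0 := by rintro rfl; norm_num at hw
  set v := Complex.exp (Complex.log w / 2) with hv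
  have hv1 : 1 ≤ ‖v‖ := by
    rw [hnorm w hw0]
    exact Real.one_le_sqrt.2 hw
  have hcv : c * ‖v‖ ≤ v.re := by
    have him : (Complex.log w / 2).im = w.arg / 2 := by
      rw [show (2 : ℂ) = ((2 : ℝ) : ℂ) by norm_num, Complex.div_ofReal_im, Complex.log_im]
    rw [hv, Complex.exp_re, Complex.norm_exp, him, mul_comm]
    gcongr
    rw [hcdef, ← Real.cos_abs (w.arg / 2), abs_div, abs_two]
    have : |w.arg| ≤ Real.pi - ε := by
      have := min_le_left δ Real.pi
      exact (harg : |w.arg| ≤ Real.pi - δ).trans (by linarith)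
    exact Real.cos_le_cos_of_nonneg_of_le_pi (by positivity) (by linarith) (by linarith)
  have hmv : c ≤ v.re := by nlinarith
  rw [laplaceExt, ← hv, laplaceRay, norm_mul, norm_inv, hv, hnorm w hw0, ← hv]
  gcongr
  refine MeasureTheory.norm_integral_le_of_norm_le (integrableOn_one_add_pow_mul_exp _ k hc) ?_
  filter_upwards [MeasureTheory.ae_restrict_mem measurableSet_Ioi] with r hr
  exact norm_exp_mul_comp_div_le hc hC h hcv hmv hr

end

/-! ### Continuation of the zeta function and of the log-gamma function. -/

section

variable {f : ℂ → ℂ}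

theorem Gamma_eq_mul_prod (M : ℕ) : ∀ {s : ℂ}, (M : ℝ) < s.re →
    Complex.Gamma s = Complex.Gamma (s - M) * ∏ j ∈ Finset.range M, (s - (j + 1)) := by
  induction M with
  | zero => intro s _; simp
  | succ M ih =>
    intro s hs
    push_cast at hs
    have hne : s - (M + 1) ≠ 0 := by
      intro h
      have := congrArg Complex.re h
      simp at this
      linarith
    rw [ih (by linarith), Finset.prod_range_succ, show s - (M : ℂ) = s - (M + 1) + 1 by ring,
      Complex.Gamma_add_one _ hne]
    push_cast
    ring

/-- The continuation of `zetaIntegral f M s w` in `s`. -/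
noncomputable def zetaExt (f : ℂ → ℂ) (M : ℕ) (s w : ℂ) : ℂ :=
  mellinGammaExt f (s - M) w * (∏ j ∈ Finset.range M, (s - (j + 1)))⁻¹

/-- Division by `t ^ M` lowers the Mellin variable to `s - M`; replacing `1 / Γ(s)` by `1 / Γ(s -
M)` costs the product that carries the poles. -/
theorem zetaIntegral_eq_zetaExt (hf : RuijsenaarsClass f) {M : ℕ} {s w : ℂ} (hs : (M : ℝ) < s.re)
    (hw : 0 < w.re) : zetaIntegral f M s w = zetaExt f M s w := by
  have hre : 0 < (s - M).re := by simpa using hs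
  have hint : ∫ t in Set.Ioi (0 : ℝ), (t : ℂ) ^ (s - 1) * Complex.exp (-w * t) *
      (f t / (t : ℂ) ^ M) = mellin (fun t : ℝ => Complex.exp (-w * t) * f t) (s - M) := by
    refine MeasureTheory.setIntegral_congr_fun measurableSet_Ioi fun t ht => ?_
    have ht0 : (t : ℂ) ≠ 0 := by exact_mod_cast (ne_of_gt ht)
    simp only [smul_eq_mul]
    rw [show s - (M : ℂ) - 1 = s - 1 - M by ring, Complex.cpow_sub _ (M : ℂ) ht0,
      Complex.cpow_natCast]
    ring
  rw [zetaIntegral, zetaExt, hint, mellinGammaExt_eq_mellinGamma hf hre hw, mellinGamma,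
    Gamma_eq_mul_prod M hs, one_div, mul_inv]
  ring

theorem prod_sub_ne_zero {M : ℕ} {s : ℂ} (hs : ∀ k : ℕ, 1 ≤ k → k ≤ M → s ≠ (k : ℂ)) :
    ∏ j ∈ Finset.range M, (s - ((j : ℂ) + 1)) ≠ 0 := by
  refine Finset.prod_ne_zero_iff.2 fun j hj => sub_ne_zero.2 ?_
  have := hs (j + 1) (by omega) (by have := Finset.mem_range.1 hj; omega)
  exact_mod_cast this

theorem isOpen_compl_poles (M : ℕ) : IsOpen {z : ℂ | ∀ k : ℕ, 1 ≤ k → k ≤ M → z ≠ (k : ℂ)} ∧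
    IsPreconnected {z : ℂ | ∀ k : ℕ, 1 ≤ k → k ≤ M → z ≠ (k : ℂ)} := by
  have h : {z : ℂ | ∀ k : ℕ, 1 ≤ k → k ≤ M → z ≠ (k : ℂ)}
      = ((Nat.cast : ℕ → ℂ) '' Set.Icc 1 M)ᶜ := by
    ext z
    simp only [Set.mem_ofPred_eq, Set.mem_compl_iff, Set.mem_image, Set.mem_Icc, not_exists,
      not_and, and_imp]
    exact ⟨fun h k h1 h2 h3 => h k h1 h2 h3.symm, fun h k h1 h2 h3 => h k h1 h2 h3.symm⟩
  have hfin : ((Nat.cast : ℕ → ℂ) '' Set.Icc 1 M).Finite := (Set.finite_Icc 1 M).image _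
  rw [h]
  refine ⟨hfin.isClosed.isOpen_compl, ?_⟩
  -- The plane has real dimension two, so removing countably many points leaves it path connected.
  exact (hfin.countable.isPathConnected_compl_of_one_lt_rank
    (by rw [Complex.rank_real_complex]; exact Cardinal.one_lt_two)).isConnected.isPreconnected

theorem zeta_eqOn_zetaExt (hf : RuijsenaarsClass f) (M : ℕ) {w : ℂ} (hw : 0 < w.re) :
    Set.EqOn (fun s => zeta f M s w) (fun s => zetaExt f M s w)
      {z : ℂ | ∀ k : ℕ, 1 ≤ k → k ≤ M → z ≠ (k : ℂ)} := by
  refine analyticContinuation_eqOn (isOpen_lt continuous_const Complex.continuous_re)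
    ⟨(M + 1 : ℝ), by simp⟩ ?_ (isOpen_compl_poles M).2 ⟨?_, fun s hs => ?_⟩
  · rintro z hz k - hk rfl
    simp only [Set.mem_ofPred_eq, Complex.natCast_re] at hz
    exact absurd hk (not_le.2 (by exact_mod_cast hz))
  · refine DifferentiableOn.analyticOnNhd (fun s hs => ?_) (isOpen_compl_poles M).1
    refine DifferentiableAt.differentiableWithinAt (DifferentiableAt.mul ?_ ?_)
    · exact (differentiable_mellinGammaExt hf hw (s - M)).comp s (differentiableAt_id.sub_const _)
    · exact DifferentiableAt.inv (by fun_prop) (prod_sub_ne_zero hs)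
  · exact (zetaIntegral_eq_zetaExt hf hs hw).symm

/-- The reciprocal of `(s - 1) ⋯ (s - M)`. -/
noncomputable def invProd (M : ℕ) (s : ℂ) : ℂ := (∏ j ∈ Finset.range M, (s - (j + 1)))⁻¹

theorem differentiableAt_invProd (M : ℕ) : DifferentiableAt ℂ (invProd M) 0 :=
  DifferentiableAt.inv (by fun_prop) (prod_sub_ne_zero fun k h1 _ h => by
    have : k = 0 := by exact_mod_cast h.symm
    omega)

theorem invProd_zero (M : ℕ) : invProd M 0 * ((-1) ^ M * (M.factorial : ℂ)) = 1 := by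
  have h : ∏ j ∈ Finset.range M, ((0 : ℂ) - (j + 1)) = (-1) ^ M * (M.factorial : ℂ) := by
    simp_rw [zero_sub, ← Finset.prod_range_add_one_eq_factorial]
    rw [Finset.prod_neg]
    push_cast
    simp
  rw [invProd, h, inv_mul_cancel₀]
  exact mul_ne_zero (by simp) (by exact_mod_cast M.factorial_ne_zero)

/-- The derivative at `s = 0` of `w ^ (M - s) / ((s - 1) ⋯ (s - M))`. -/
noncomputable def logTerm (M : ℕ) (w : ℂ) : ℂ :=
  deriv (invProd M) 0 * w ^ M - invProd M 0 * (w ^ M * Complex.log w)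

theorem hasDerivAt_logTerm (M : ℕ) {w : ℂ} (hw : w ≠ 0) :
    HasDerivAt (fun s : ℂ => w ^ (-(s - M)) * invProd M s) (logTerm M w) 0 := by
  have h1 : HasDerivAt (fun s : ℂ => -(s - M)) (-1) 0 := ((hasDerivAt_id _).sub_const _).neg
  have h2 := h1.const_cpow (c := w) (Or.inl hw)
  refine (h2.mul (differentiableAt_invProd M).hasDerivAt).congr_deriv ?_
  simp only [zero_sub, neg_neg, Complex.cpow_natCast, logTerm]
  ring

/-- The continuation of `logGamma f M` to the slit plane, by recursion on `M`. -/
noncomputable def logGammaExt : ℕ → (ℂ → ℂ) → ℂ → ℂ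
  | 0, f, w => f 0 * logTerm 0 w + laplaceExt (dslope f 0) w
  | M + 1, f, w => f 0 * logTerm (M + 1) w + logGammaExt M (dslope f 0) w

theorem differentiableOn_logTerm (M : ℕ) : DifferentiableOn ℂ (logTerm M) Complex.slitPlane := by
  intro w hw
  have h : DifferentiableAt ℂ (fun w : ℂ => w ^ M) w := differentiableAt_pow M
  exact ((h.const_mul _).sub
    ((h.mul (Complex.differentiableAt_log hw)).const_mul _)).differentiableWithinAt

theorem differentiableOn_logGammaExt (M : ℕ) : ∀ {f : ℂ → ℂ}, RuijsenaarsClass f →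
    DifferentiableOn ℂ (logGammaExt M f) Complex.slitPlane := by
  induction M with
  | zero =>
    intro f hf
    exact ((differentiableOn_logTerm 0).const_mul _).add (differentiableOn_laplaceExt hf.dslope_zero)
  | succ M ih =>
    intro f hf
    exact ((differentiableOn_logTerm (M + 1)).const_mul _).add (ih hf.dslope_zero)

/-- In the Mellin recursion at `u = s - M` the factor `u` cancels the last factor of the product,
leaving the function for `M - 1` and `dslope f 0`. For `M = 0` that factor is `s` itself, so the
derivative at `0` is the value of the Mellin term at `1`, a Laplace transform. -/
theorem hasDerivAt_zetaExt (M : ℕ) : ∀ {f : ℂ → ℂ}, RuijsenaarsClass f → ∀ {w : ℂ}, 0 < w.re →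
    HasDerivAt (fun s => zetaExt f M s w) (logGammaExt M f w) 0 := by
  induction M with
  | zero =>
    intro f hf w hw
    have hw0 : w ≠ 0 := by rintro rfl; simp at hw
    have h1 := (hasDerivAt_logTerm 0 hw0).const_mul (f 0)
    have h2 : HasDerivAt (fun s => s * mellinGammaExt (dslope f 0) (s + 1) w)
        (laplaceExt (dslope f 0) w) 0 := by
      have hd : DifferentiableAt ℂ (fun s => mellinGammaExt (dslope f 0) (s + 1) w) 0 :=
        (differentiable_mellinGammaExt hf.dslope_zero hw (0 + 1)).comp 0
          (differentiableAt_id.add_const 1)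
      refine ((hasDerivAt_id (0 : ℂ)).mul hd.hasDerivAt).congr_deriv ?_
      rw [laplaceExt_eq hf.dslope_zero hw, ← mellinGamma_one,
        ← mellinGammaExt_eq_mellinGamma hf.dslope_zero (by simp) hw]
      simp
    refine (h1.add h2).congr_of_eventuallyEq (Eventually.of_forall fun s => ?_)
    simp [zetaExt, invProd, mellinGammaExt_recursion hf s hw]
  | succ M ih =>
    intro f hf w hw
    have hw0 : w ≠ 0 := by rintro rfl; simp at hw
    have h1 := (hasDerivAt_logTerm (M + 1) hw0).const_mul (f 0)
    refine (h1.add (ih hf.dslope_zero hw)).congr_of_eventuallyEq ?_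
    have hne : ∀ᶠ s : ℂ in 𝓝 0, s - ((M : ℂ) + 1) ≠ 0 := by
      refine ContinuousAt.eventually_ne (by fun_prop) ?_
      rw [zero_sub, neg_ne_zero]
      exact_mod_cast M.succ_ne_zero
    filter_upwards [hne] with s hs
    simp only [zetaExt, invProd, Pi.add_apply]
    rw [mellinGammaExt_recursion hf _ hw, Finset.prod_range_succ, mul_inv]
    push_cast
    rw [show s - ((M : ℂ) + 1) + 1 = s - M by ring]
    field_simp

theorem logGamma_eqOn (hf : RuijsenaarsClass f) (M : ℕ) :
    Set.EqOn (logGamma f M) (logGammaExt M f) Complex.slitPlane := by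
  refine analyticContinuation_eqOn isOpen_re_pos ⟨1, by simp⟩ (fun w hw => Or.inl hw)
    ?_ ⟨(differentiableOn_logGammaExt M hf).analyticOnNhd Complex.isOpen_slitPlane, ?_⟩
  · exact (Complex.starConvex_one_slitPlane.isPathConnected
      Complex.one_mem_slitPlane).isConnected.isPreconnected
  · intro w hw
    have hmem : (0 : ℂ) ∈ {z : ℂ | ∀ k : ℕ, 1 ≤ k → k ≤ M → z ≠ (k : ℂ)} := fun k h1 _ h => by
      have : k = 0 := by exact_mod_cast h.symm
      omega
    have hev : (fun s => zeta f M s w) =ᶠ[𝓝 0] fun s => zetaExt f M s w := by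
      filter_upwards [(isOpen_compl_poles M).1.mem_nhds hmem] with s hs
      exact zeta_eqOn_zetaExt hf M hw hs
    exact ((hasDerivAt_zetaExt M hf hw).congr_of_eventuallyEq hev).deriv.symm

end

/-! ### The operator `S_N` on polynomials. -/

theorem opS_eq_sum_powerset (N : ℕ) (b : ℕ → ℝ) (F : ℂ → ℂ) (q : ℂ) :
    opS N b F q = ∑ T ∈ (Finset.Icc 1 N).powerset,
      (-1 : ℂ) ^ T.card * F (q + (b 0 + ∑ k ∈ T, (b k : ℂ))) := by
  rw [Finset.sum_powerset, Nat.card_Icc, Nat.add_sub_cancel, opS]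
  refine Finset.sum_congr rfl fun p _ => ?_
  rw [Finset.mul_sum]
  refine Finset.sum_congr rfl fun T hT => ?_
  rw [(Finset.mem_powersetCard.1 hT).2, add_assoc]

theorem opS_add (N : ℕ) (b : ℕ → ℝ) (F G : ℂ → ℂ) (q : ℂ) :
    opS N b (fun w => F w + G w) q = opS N b F q + opS N b G q := by
  simp only [opS_eq_sum_powerset, mul_add, Finset.sum_add_distrib]

theorem opS_const_mul (N : ℕ) (b : ℕ → ℝ) (a : ℂ) (F : ℂ → ℂ) (q : ℂ) :
    opS N b (fun w => a * F w) q = a * opS N b F q := by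
  simp only [opS_eq_sum_powerset, Finset.mul_sum]
  exact Finset.sum_congr rfl fun T _ => by ring

/-- The alternating sum of powers of subset sums. -/
theorem sum_powerset_neg_one_pow_mul_pow {ι : Type*} [DecidableEq ι] (c : ι → ℂ) (s : Finset ι) :
    ∀ (x : ℂ) (j : ℕ), j ≤ s.card →
      ∑ T ∈ s.powerset, (-1 : ℂ) ^ T.card * (x + ∑ k ∈ T, c k) ^ j
        = if j = s.card then (-1) ^ s.card * (s.card.factorial : ℂ) * ∏ k ∈ s, c k else 0 := by
  induction s using Finset.induction with
  | empty =>
    intro x j hj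
    have : j = 0 := by simpa using hj
    simp [this]
  | insert a s ha ih =>
    intro x j hj
    rw [Finset.card_insert_of_notMem ha] at hj ⊢
    rw [Finset.sum_powerset_insert ha, ← Finset.sum_add_distrib]
    -- Pairing `T` with `insert a T` produces the first difference `y ^ j - (y + c a) ^ j`, whose
    -- leading terms cancel, so the degree drops by one.
    have hterm : ∀ T ∈ s.powerset,
        (-1 : ℂ) ^ T.card * (x + ∑ k ∈ T, c k) ^ j
          + (-1) ^ (insert a T).card * (x + ∑ k ∈ insert a T, c k) ^ j
        = ∑ i ∈ Finset.range j, -((c a) ^ (j - i) * (j.choose i : ℂ)) *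
            ((-1) ^ T.card * (x + ∑ k ∈ T, c k) ^ i) := by
      intro T hT
      have haT : a ∉ T := fun h => ha (Finset.mem_powerset.1 hT h)
      rw [Finset.card_insert_of_notMem haT, Finset.sum_insert haT,
        show x + (c a + ∑ k ∈ T, c k) = (x + ∑ k ∈ T, c k) + c a by ring]
      generalize x + ∑ k ∈ T, c k = y
      have hsum : ∑ i ∈ Finset.range j, -((c a) ^ (j - i) * (j.choose i : ℂ)) *
          ((-1) ^ T.card * y ^ i) = -(-1) ^ T.card *
            ∑ i ∈ Finset.range j, y ^ i * (c a) ^ (j - i) * (j.choose i : ℂ) := by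
        rw [Finset.mul_sum]
        exact Finset.sum_congr rfl fun i _ => by ring
      rw [hsum, add_pow, Finset.sum_range_succ]
      simp only [Nat.sub_self, pow_zero, mul_one, Nat.choose_self, Nat.cast_one, pow_succ]
      ring
    rw [Finset.sum_congr rfl hterm, Finset.sum_comm]
    simp_rw [← Finset.mul_sum]
    have hi : ∀ i ∈ Finset.range j, -((c a) ^ (j - i) * (j.choose i : ℂ)) *
        ∑ T ∈ s.powerset, (-1 : ℂ) ^ T.card * (x + ∑ k ∈ T, c k) ^ i
        = -((c a) ^ (j - i) * (j.choose i : ℂ)) * if i = s.card then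
          (-1) ^ s.card * (s.card.factorial : ℂ) * ∏ k ∈ s, c k else 0 := fun i hi => by
      rw [ih x i (by have := Finset.mem_range.1 hi; omega)]
    rw [Finset.sum_congr rfl hi]
    simp only [mul_ite, mul_zero, Finset.sum_ite_eq', Finset.mem_range]
    by_cases hjs : j = s.card + 1
    · subst hjs
      rw [if_pos (Nat.lt_succ_self _), if_pos rfl, Finset.prod_insert ha, Nat.factorial_succ,
        Nat.add_sub_cancel_left, Nat.choose_succ_self_right]
      push_cast
      ring
    · rw [if_neg hjs, if_neg (by omega)]

/-- The value of `opS N b` on `w ^ m`, for `m ≤ N`. -/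
noncomputable def powDiff (N : ℕ) (b : ℕ → ℝ) (m : ℕ) : ℂ :=
  if m = N then (-1) ^ N * (N.factorial : ℂ) * ∏ k ∈ Finset.Icc 1 N, (b k : ℂ) else 0

theorem sum_powerset_Icc_pow {N m : ℕ} (hm : m ≤ N) (b : ℕ → ℝ) (x : ℂ) :
    ∑ T ∈ (Finset.Icc 1 N).powerset, (-1 : ℂ) ^ T.card * (x + ∑ k ∈ T, (b k : ℂ)) ^ m
      = powDiff N b m := by
  have := sum_powerset_neg_one_pow_mul_pow (fun k => (b k : ℂ)) (Finset.Icc 1 N) x m (by simpa)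
  simpa [powDiff] using this

theorem opS_pow {N m : ℕ} (hm : m ≤ N) (b : ℕ → ℝ) (q : ℂ) :
    opS N b (fun w => w ^ m) q = powDiff N b m := by
  rw [opS_eq_sum_powerset, ← sum_powerset_Icc_pow hm b (q + b 0)]
  simp only [add_assoc]

/-! ### Expansions at infinity in a sector. -/

theorem tendsto_one_add_div (c : ℂ) :
    Tendsto (fun q : ℂ => 1 + c / q) (Bornology.cobounded ℂ) (𝓝 1) := by
  simpa [div_eq_mul_inv] using
    ((tendsto_inv₀_cobounded (α := ℂ)).const_mul c).const_add 1

/-- Since `arg (1 + c / q)` tends to `0`, it is eventually below `δ / 2`; the sum of arguments then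
stays inside `(-π, π)` and the principal logarithms add. -/
theorem eventually_log_add (c : ℂ) {δ : ℝ} (hδ : 0 < δ) :
    ∀ᶠ q in sectorAtInfinity δ, q ≠ 0 ∧
      Complex.log (q + c) = Complex.log q + Complex.log (1 + c / q) ∧
      |(q + c).arg| ≤ Real.pi - δ / 2 ∧ q + c ∈ Complex.slitPlane := by
  have h1 : Tendsto (fun q : ℂ => (1 + c / q).arg) (Bornology.cobounded ℂ) (𝓝 0) := by
    have := (Complex.continuousAt_arg Complex.one_mem_slitPlane).tendsto.comp
      (tendsto_one_add_div c)
    rwa [Complex.arg_one] at this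
  have h2 : ∀ᶠ q : ℂ in Bornology.cobounded ℂ, |(1 + c / q).arg| < δ / 2 := by
    have := h1.abs
    rw [abs_zero] at this
    exact this.eventually (gt_mem_nhds (half_pos hδ))
  have h3 : ∀ᶠ q : ℂ in Bornology.cobounded ℂ, 1 + c / q ≠ 0 :=
    (tendsto_one_add_div c).eventually_ne one_ne_zero
  rw [sectorAtInfinity, eventually_inf_principal]
  filter_upwards [h2, h3, tendsto_norm_cobounded_atTop.eventually_ge_atTop 1] with q hq2 hq3 hq1 hq
  have hq : |q.arg| ≤ Real.pi - δ := hq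
  have hq0 : q ≠ 0 := by rintro rfl; norm_num at hq1
  have hmul : q * (1 + c / q) = q + c := by field_simp
  have hq' := abs_le.1 hq
  have hq2' := abs_lt.1 hq2
  have hmem : q.arg + (1 + c / q).arg ∈ Set.Ioc (-Real.pi) Real.pi := by
    constructor <;> linarith
  have harg : |(q + c).arg| ≤ Real.pi - δ / 2 := by
    rw [← hmul, Complex.arg_mul hq0 hq3 hmem, abs_le]
    constructor <;> linarith
  refine ⟨hq0, by rw [← hmul, Complex.log_mul hq0 hq3 hmem], harg,
    Complex.mem_slitPlane_iff_arg.2 ⟨fun h => ?_, by rw [← hmul]; exact mul_ne_zero hq0 hq3⟩⟩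
  rw [h] at harg
  linarith [le_abs_self Real.pi]

theorem tendsto_add_sectorAtInfinity (c : ℂ) {δ : ℝ} (hδ : 0 < δ) :
    Tendsto (fun q => q + c) (sectorAtInfinity δ) (sectorAtInfinity (δ / 2)) := by
  refine tendsto_inf.2 ⟨?_, tendsto_principal.2 ?_⟩
  · exact (tendsto_add_const_cobounded c).mono_left (sectorAtInfinity_le δ)
  · filter_upwards [eventually_log_add c hδ] with q hq using hq.2.2.1

/-- Taylor's formula for `(1 + x) ^ m * log (1 + x)` at `x = c / q`, multiplied by `q ^ m`; the
remainder is `O(1 / ‖q‖)`. The coefficients do not depend on `c`, so `S_N` can act on the powers `c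
^ j`. -/
theorem exists_tendsto_pow_mul_log (m : ℕ) : ∃ a : ℕ → ℂ, ∀ c : ℂ,
    Tendsto (fun q : ℂ => (q + c) ^ m * Complex.log (1 + c / q)
      - ∑ j ∈ Finset.range (m + 1), a j * q ^ (m - j) * c ^ j) (Bornology.cobounded ℂ) (𝓝 0) := by
  have han : AnalyticAt ℂ (fun x : ℂ => (1 + x) ^ m * Complex.log (1 + x)) 0 := by
    have h1 : AnalyticAt ℂ (fun x : ℂ => 1 + x) 0 := by fun_prop
    exact (h1.pow m).mul (h1.clog (by simp))
  obtain ⟨p, hp⟩ := han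
  refine ⟨p.coeff, fun c => ?_⟩
  have hO := hp.isBigO_sub_partialSum_pow (m + 1)
  have hlim : Tendsto (fun q : ℂ => c / q) (Bornology.cobounded ℂ) (𝓝 0) := by
    simpa [div_eq_mul_inv] using (tendsto_inv₀_cobounded (α := ℂ)).const_mul c
  have hO2 := (hO.comp_tendsto hlim)
  have hO3 := (Asymptotics.isBigO_refl (fun q : ℂ => q ^ m) (Bornology.cobounded ℂ)).norm_right.mul hO2
  have h0 : Tendsto (fun q : ℂ => ‖c‖ ^ (m + 1) * ‖q‖⁻¹) (Bornology.cobounded ℂ) (𝓝 0) := by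
    simpa using (tendsto_norm_cobounded_atTop (E := ℂ)).inv_tendsto_atTop.const_mul (‖c‖ ^ (m + 1))
  have hne : ∀ᶠ q : ℂ in Bornology.cobounded ℂ, q ≠ 0 := by
    filter_upwards [tendsto_norm_cobounded_atTop.eventually_ge_atTop 1] with q hq
    rintro rfl
    norm_num at hq
  refine Asymptotics.IsBigO.trans_tendsto (Asymptotics.IsBigO.congr' hO3 ?_ ?_) h0
  · filter_upwards [hne] with q hq
    simp only [Function.comp, zero_add, FormalMultilinearSeries.partialSum,
      FormalMultilinearSeries.apply_eq_pow_smul_coeff, smul_eq_mul]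
    rw [mul_sub, ← mul_assoc, ← mul_pow, mul_add, mul_one, mul_div_cancel₀ _ hq, Finset.mul_sum]
    congr 1
    refine Finset.sum_congr rfl fun j hj => ?_
    have hj' : j ≤ m := Nat.lt_succ_iff.1 (Finset.mem_range.1 hj)
    rw [div_pow, ← Nat.sub_add_cancel hj', pow_add, Nat.add_sub_cancel]
    field_simp
  · filter_upwards [hne] with q hq
    have : ‖q‖ ≠ 0 := norm_ne_zero_iff.2 hq
    simp only [Function.comp, norm_pow, norm_div]
    rw [div_pow, pow_succ ‖q‖]
    field_simp

/-- Asymptotics of `opS N b` on `w ^ m log w`, for `m ≤ N`. -/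
theorem exists_tendsto_opS_pow_mul_log {N m : ℕ} (hm : m ≤ N) (b : ℕ → ℝ) :
    ∃ a : ℂ, ∀ δ : ℝ, 0 < δ → Tendsto
      (fun q => opS N b (fun w => w ^ m * Complex.log w) q - powDiff N b m * Complex.log q)
      (sectorAtInfinity δ) (𝓝 (a * powDiff N b m)) := by
  obtain ⟨a, ha⟩ := exists_tendsto_pow_mul_log m
  refine ⟨a m, fun δ hδ => ?_⟩
  set c : Finset ℕ → ℂ := fun T => b 0 + ∑ k ∈ T, (b k : ℂ) with hc
  have hlim : Tendsto (fun q => a m * powDiff N b m + ∑ T ∈ (Finset.Icc 1 N).powerset,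
      (-1 : ℂ) ^ T.card * ((q + c T) ^ m * Complex.log (1 + c T / q)
        - ∑ j ∈ Finset.range (m + 1), a j * q ^ (m - j) * c T ^ j))
      (sectorAtInfinity δ) (𝓝 (a m * powDiff N b m + ∑ T ∈ (Finset.Icc 1 N).powerset,
        (-1 : ℂ) ^ T.card * 0)) :=
    (tendsto_finsetSum _ fun T _ =>
      ((ha (c T)).const_mul _).mono_left (sectorAtInfinity_le δ)).const_add _
  simp only [mul_zero, Finset.sum_const_zero, add_zero] at hlim
  refine hlim.congr' ?_
  have hev : ∀ᶠ q in sectorAtInfinity δ, ∀ T ∈ (Finset.Icc 1 N).powerset,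
      Complex.log (q + c T) = Complex.log q + Complex.log (1 + c T / q) :=
    (Filter.eventually_all_finset _).2 fun T _ =>
      (eventually_log_add (c T) hδ).mono fun q hq => hq.2.1
  filter_upwards [hev] with q hq
  -- The alternating sum annihilates `c T ^ j` for `j < m ≤ N`, hence every positive power of `q`;
  -- only the constant term `j = m` can remain.
  have h1 : ∑ T ∈ (Finset.Icc 1 N).powerset, (-1 : ℂ) ^ T.card *
      ∑ j ∈ Finset.range (m + 1), a j * q ^ (m - j) * c T ^ j = a m * powDiff N b m := by
    simp_rw [Finset.mul_sum]
    rw [Finset.sum_comm]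
    have : ∀ j ∈ Finset.range (m + 1), ∑ T ∈ (Finset.Icc 1 N).powerset,
        (-1 : ℂ) ^ T.card * (a j * q ^ (m - j) * c T ^ j)
        = a j * q ^ (m - j) * powDiff N b j := fun j hj => by
      have hj' := Finset.mem_range.1 hj
      rw [← sum_powerset_Icc_pow (by omega) b (b 0), Finset.mul_sum]
      exact Finset.sum_congr rfl fun T _ => by ring
    rw [Finset.sum_congr rfl this, Finset.sum_range_succ, Finset.sum_eq_zero, zero_add]
    · simp
    · intro j hj
      have := Finset.mem_range.1 hj
      rw [powDiff, if_neg (by omega), mul_zero]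
  have h2 : opS N b (fun w => w ^ m * Complex.log w) q = powDiff N b m * Complex.log q
      + ∑ T ∈ (Finset.Icc 1 N).powerset,
        (-1 : ℂ) ^ T.card * ((q + c T) ^ m * Complex.log (1 + c T / q)) := by
    rw [← opS_pow hm b q, opS_eq_sum_powerset, opS_eq_sum_powerset, Finset.sum_mul,
      ← Finset.sum_add_distrib]
    refine Finset.sum_congr rfl fun T hT => ?_
    rw [hq T hT]
    ring
  simp only [mul_sub, Finset.sum_sub_distrib, h1, h2]
  ring

theorem tendsto_opS {F : ℂ → ℂ} (hF : ∀ δ : ℝ, 0 < δ → Tendsto F (sectorAtInfinity δ) (𝓝 0))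
    (N : ℕ) (b : ℕ → ℝ) {δ : ℝ} (hδ : 0 < δ) :
    Tendsto (opS N b F) (sectorAtInfinity δ) (𝓝 0) := by
  rw [funext (opS_eq_sum_powerset N b F)]
  have := tendsto_finsetSum (Finset.Icc 1 N).powerset fun T _ =>
    ((hF _ (half_pos hδ)).comp
      (tendsto_add_sectorAtInfinity (b 0 + ∑ k ∈ T, (b k : ℂ)) hδ)).const_mul ((-1 : ℂ) ^ T.card)
  simpa using this

theorem exists_tendsto_opS_logTerm {N m : ℕ} (hm : m ≤ N) (b : ℕ → ℝ) :
    ∃ a : ℂ, ∀ δ : ℝ, 0 < δ → Tendsto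
      (fun q => opS N b (logTerm m) q + invProd m 0 * powDiff N b m * Complex.log q)
      (sectorAtInfinity δ) (𝓝 (a * powDiff N b m)) := by
  obtain ⟨a, ha⟩ := exists_tendsto_opS_pow_mul_log hm b
  refine ⟨deriv (invProd m) 0 - invProd m 0 * a, fun δ hδ => ?_⟩
  have h := ((ha δ hδ).const_mul (-invProd m 0)).const_add (deriv (invProd m) 0 * powDiff N b m)
  convert! h using 1
  · funext q
    have : opS N b (logTerm m) q = opS N b (fun w => deriv (invProd m) 0 * w ^ m
        + (-invProd m 0) * (w ^ m * Complex.log w)) q := by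
      congr 1
      funext w
      rw [logTerm]
      ring
    rw [this, opS_add N b (fun w => deriv (invProd m) 0 * w ^ m), opS_const_mul, opS_const_mul,
      opS_pow hm]
    ring
  · ring_nf

/-! ### Asymptotics of `S_N L_M`. -/

theorem tendsto_opS_logGammaExt_of_lt {N : ℕ} (b : ℕ → ℝ) (M : ℕ) : ∀ {f : ℂ → ℂ},
    RuijsenaarsClass f → M < N → ∀ {δ : ℝ}, 0 < δ →
      Tendsto (opS N b (logGammaExt M f)) (sectorAtInfinity δ) (𝓝 0) := by
  have hterm : ∀ m < N, ∀ {δ : ℝ}, 0 < δ →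
      Tendsto (opS N b (logTerm m)) (sectorAtInfinity δ) (𝓝 0) := by
    intro m hm δ hδ
    obtain ⟨a, ha⟩ := exists_tendsto_opS_logTerm hm.le b
    simpa [powDiff, hm.ne] using ha δ hδ
  induction M with
  | zero =>
    intro f hf hM δ hδ
    have h := ((hterm 0 hM hδ).const_mul (f 0)).add
      (tendsto_opS (fun δ hδ => tendsto_laplaceExt hf.dslope_zero hδ) N b hδ)
    rw [mul_zero, add_zero] at h
    refine h.congr fun q => ?_
    rw [← opS_const_mul, ← opS_add]
    rfl
  | succ M ih =>
    intro f hf hM δ hδ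
    have h := ((hterm (M + 1) hM hδ).const_mul (f 0)).add (ih hf.dslope_zero (by omega) hδ)
    rw [mul_zero, add_zero] at h
    refine h.congr fun q => ?_
    rw [← opS_const_mul, ← opS_add]
    rfl

theorem exists_tendsto_opS_logGammaExt_self {f : ℂ → ℂ} (hf : RuijsenaarsClass f) (b : ℕ → ℝ)
    (N : ℕ) : ∃ a : ℂ, ∀ δ : ℝ, 0 < δ → Tendsto
      (fun q => opS N b (logGammaExt N f) q
        + (∏ j ∈ Finset.Icc 1 N, (b j : ℂ)) * f 0 * Complex.log q)
      (sectorAtInfinity δ) (𝓝 a) := by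
  -- Past its top term, `L_N` is a Laplace transform if `N = 0` and otherwise an `L_{N-1}`, to which
  -- the case `M < N` applies.
  obtain ⟨G, hG, hlim⟩ : ∃ G : ℂ → ℂ, (∀ w, logGammaExt N f w = f 0 * logTerm N w + G w) ∧
      ∀ δ : ℝ, 0 < δ → Tendsto (opS N b G) (sectorAtInfinity δ) (𝓝 0) := by
    cases N with
    | zero => exact ⟨_, fun _ => rfl, fun δ hδ =>
        tendsto_opS (fun δ hδ => tendsto_laplaceExt hf.dslope_zero hδ) 0 b hδ⟩
    | succ N => exact ⟨_, fun _ => rfl, fun δ hδ =>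
        tendsto_opS_logGammaExt_of_lt b N hf.dslope_zero N.lt_succ_self hδ⟩
  obtain ⟨a, ha⟩ := exists_tendsto_opS_logTerm (le_refl N) b
  refine ⟨f 0 * (a * powDiff N b N) + 0, fun δ hδ => ?_⟩
  refine (((ha δ hδ).const_mul (f 0)).add (hlim δ hδ)).congr fun q => ?_
  have hp : invProd N 0 * powDiff N b N = ∏ j ∈ Finset.Icc 1 N, (b j : ℂ) := by
    rw [powDiff, if_pos rfl, ← mul_assoc, invProd_zero, one_mul]
  rw [funext hG, opS_add N b (fun w => f 0 * logTerm N w), opS_const_mul, hp]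
  ring

/-- The two continuations are known to agree only on the slit plane, which contains all the shifted
arguments once `q` is far out in the sector. -/
theorem eventually_opS_logGamma_eq {f : ℂ → ℂ} (hf : RuijsenaarsClass f) (M N : ℕ) (b : ℕ → ℝ)
    {δ : ℝ} (hδ : 0 < δ) :
    ∀ᶠ q in sectorAtInfinity δ, opS N b (logGamma f M) q = opS N b (logGammaExt M f) q := by
  have hev : ∀ᶠ q in sectorAtInfinity δ, ∀ T ∈ (Finset.Icc 1 N).powerset,
      q + (b 0 + ∑ k ∈ T, (b k : ℂ)) ∈ Complex.slitPlane :=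
    (Filter.eventually_all_finset _).2 fun T _ =>
      (eventually_log_add _ hδ).mono fun q hq => hq.2.2.2
  filter_upwards [hev] with q hq
  rw [opS_eq_sum_powerset, opS_eq_sum_powerset]
  exact Finset.sum_congr rfl fun T hT => by rw [logGamma_eqOn hf M (hq T hT)]

end BarnesBeta

theorem mainTheorem3 (f : ℂ → ℂ) (hf : BarnesBeta.RuijsenaarsClass f)
    (hpos : ∀ t : ℝ, 0 ≤ t → 0 < (f t).re ∧ (f t).im = 0)
    (b : ℕ → ℝ) (hb : ∀ k, 0 < b k) (M N : ℕ) :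
    (M < N → ∀ δ : ℝ, 0 < δ →
      Tendsto (BarnesBeta.eta f M N b) (BarnesBeta.sectorAtInfinity δ)
        (𝓝 (Complex.exp (-BarnesBeta.opS N b (BarnesBeta.logGamma f M) 0)))) ∧
    (M = N → ∃ r : ℂ → ℂ,
      (∀ q ∈ Complex.slitPlane,
        BarnesBeta.opS N b (BarnesBeta.logGamma f N) q
            - BarnesBeta.opS N b (BarnesBeta.logGamma f N) 0
          = -(∏ j ∈ Finset.Icc 1 N, (b j : ℂ)) * f 0 * Complex.log q + r q ∧
        BarnesBeta.eta f N N b q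
          = Complex.exp (-(∏ j ∈ Finset.Icc 1 N, (b j : ℂ)) * f 0 * Complex.log q + r q)) ∧
      ∀ δ : ℝ, 0 < δ →
        r =O[BarnesBeta.sectorAtInfinity δ] fun _ => (1 : ℝ)) := by
  refine ⟨fun hMN δ hδ => ?_, fun _ => ?_⟩
  · have h := (BarnesBeta.tendsto_opS_logGammaExt_of_lt b M hf hMN hδ).congr'
      ((BarnesBeta.eventually_opS_logGamma_eq hf M N b hδ).mono fun q hq => hq.symm)
    have h2 := (h.sub_const (BarnesBeta.opS N b (BarnesBeta.logGamma f M) 0)).cexp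
    rwa [zero_sub] at h2
  · obtain ⟨a, ha⟩ := BarnesBeta.exists_tendsto_opS_logGammaExt_self hf b N
    -- The remainder `r` is taken to be the exact difference, so both identities are automatic; its
    -- boundedness follows from convergence in each sector.
    have hr : ∀ q : ℂ, BarnesBeta.opS N b (BarnesBeta.logGamma f N) q
        - BarnesBeta.opS N b (BarnesBeta.logGamma f N) 0
        = -(∏ j ∈ Finset.Icc 1 N, (b j : ℂ)) * f 0 * Complex.log q
          + (BarnesBeta.opS N b (BarnesBeta.logGamma f N) q
            + (∏ j ∈ Finset.Icc 1 N, (b j : ℂ)) * f 0 * Complex.log q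
            - BarnesBeta.opS N b (BarnesBeta.logGamma f N) 0) := fun q => by ring
    refine ⟨_, fun q _ => ⟨hr q, ?_⟩, fun δ hδ => ?_⟩
    · rw [BarnesBeta.eta, hr q]
    · refine Tendsto.isBigO_one ℝ (c := a - BarnesBeta.opS N b (BarnesBeta.logGamma f N) 0) ?_
      refine Tendsto.sub_const ((ha δ hδ).congr' ?_) _
      filter_upwards [BarnesBeta.eventually_opS_logGamma_eq hf N N b hδ] with q hq
      rw [hq]
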